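/- Let $A\in M_n(\mathbb{C})$ be nonsingular, and let $L\in M_n(\mathbb{C})$ be a limit of complex roots of $A$: there are a strictly increasing sequence of positive integers $(c_i)_{i\ge 1}$ and matrices $B_i\in M_n(\mathbb{C})$ with $B_i^{c_i}=A$ for all $i$ and $\lim_{i\to\infty}B_i=L$. For a square complex matrix $X$ write $\sigma_*(X)$ for the set of distinct nonzero eigenvalues of $X$ and $\mathcal{E}(\mu,X)$ for the generalised eigenspace of $X$ for the eigenvalue $\mu$. For $\lambda\in\sigma_*(A)$ and $\nu\in\sigma_*(L)$ put $$M[\lambda,\nu]:=\dim\bigl(\mathcal{E}(\lambda,A)\cap\mathcal{E}(\nu,L)\bigr).$$ An eigenvalue is called simple if its algebraic multiplicity is $1$. 1. If $L$ has only simple eigenvalues, then for every $\lambda\in\sigma_*(A)$, $$\mathcal{E}(\lambda,A)=\operatorname{span}\bigcup\{\mathcal{E}(\nu,L):\nu\in\sigma_*(L),\ M[\lambda,\nu]\neq 0\}.$$ 2. If $A$ has only simple eigenvalues, then for every $\nu\in\sigma_*(L)$, $$\mathcal{E}(\nu,L)=\operatorname{span}\bigcup\{\mathcal{E}(\lambda,A):\lambda\in\sigma_*(A),\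 M[\lambda,\nu]\neq 0\}.$$ 3. If $L$ has only simple eigenvalues or $A$ has only simple eigenvalues, then $A$ and $L$ are simultaneously diagonalisable: there is an invertible matrix $Z\in M_n(\mathbb{C})$ such that $Z^{-1}AZ$ and $Z^{-1}LZ$ are both diagonal. -/

import Mathlib

open Filter Topology

namespace MatrixRoots

/-- The set of positive exponents `c` for which `A` has a `c`-th root in `S`. -/
def rootExponents {n : ℕ} (S : Set (Matrix (Fin n) (Fin n) ℂ))
    (A : Matrix (Fin n) (Fin n) ℂ) : Set ℕ :=
  {c | 1 ≤ c ∧ ∃ B ∈ S, B ^ c = A}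

/-- The set of all roots of `A`, of any positive order, that lie in `S`. -/
def roots {n : ℕ} (S : Set (Matrix (Fin n) (Fin n) ℂ))
    (A : Matrix (Fin n) (Fin n) ℂ) : Set (Matrix (Fin n) (Fin n) ℂ) :=
  {B | B ∈ S ∧ ∃ c : ℕ, 1 ≤ c ∧ B ^ c = A}

/-- The set of all limits of `S`-roots of `A`: limits of convergent sequences `B i` of roots of `A`
in `S` with `B i ^ c i = A` for a strictly increasing sequence of exponents `c i`. -/
def rootLimits {n : ℕ} (S : Set (Matrix (Fin n) (Fin n) ℂ))
    (A : Matrix (Fin n) (Fin n) ℂ) : Set (Matrix (Fin n) (Fin n) ℂ) :=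
  {L | ∃ (c : ℕ → ℕ) (B : ℕ → Matrix (Fin n) (Fin n) ℂ),
    StrictMono c ∧ (∀ i, c i ∈ rootExponents S A) ∧ (∀ i, B i ∈ roots S A) ∧
      (∀ i, B i ^ c i = A) ∧ Tendsto B atTop (𝓝 L)}

/-- Limits of complex roots of `A`. -/
def complexRootLimits {n : ℕ} (A : Matrix (Fin n) (Fin n) ℂ) :
    Set (Matrix (Fin n) (Fin n) ℂ) :=
  rootLimits Set.univ A

/-- The set of distinct nonzero eigenvalues of `A`. -/
def nonzeroEigenvalues {n : ℕ} (A : Matrix (Fin n) (Fin n) ℂ) : Set ℂ :=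
  {lam | Module.End.HasEigenvalue (Matrix.toLin' A) lam ∧ lam ≠ 0}

/-- The generalised eigenspace of `A` for `lam`. -/
noncomputable def genEigenspace {n : ℕ} (lam : ℂ) (A : Matrix (Fin n) (Fin n) ℂ) :
    Submodule ℂ (Fin n → ℂ) :=
  Module.End.maxGenEigenspace (Matrix.toLin' A) lam

/-- The algebraic multiplicity of `lam` as an eigenvalue of `A`. -/
noncomputable def algMult {n : ℕ} (lam : ℂ) (A : Matrix (Fin n) (Fin n) ℂ) : ℕ :=
  A.charpoly.rootMultiplicity lam

/-- Every eigenvalue of `A` has algebraic multiplicity one. -/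
def HasOnlySimpleEigenvalues {n : ℕ} (A : Matrix (Fin n) (Fin n) ℂ) : Prop :=
  ∀ lam : ℂ, Module.End.HasEigenvalue (Matrix.toLin' A) lam → algMult lam A = 1

/-- The multiplicity rearrangement matrix for `(A, L)`: rows are indexed by the distinct nonzero
eigenvalues of `A`, columns by those of `L`. -/
noncomputable def multRearrangement {n : ℕ} (A L : Matrix (Fin n) (Fin n) ℂ) :
    Matrix (nonzeroEigenvalues A) (nonzeroEigenvalues L) ℕ :=
  Matrix.of fun lam nu =>
    Module.finrank ℂ ↥(genEigenspace (lam : ℂ) A ⊓ genEigenspace (nu : ℂ) L)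

end MatrixRoots

open Module

section CommutingEndomorphisms

variable {K V : Type*} [Field K] [AddCommGroup V] [Module K V] {f g : End K V}

/-! Each `B i` commutes with its power `A`, so the limit `L` does too. Since `‖det (B i)‖ = ‖det A‖
^ (1 / c i)` tends to `1`, `L` is invertible and has no eigenvalue `0`. The rest concerns commuting
`f`, `g`: each generalised eigenspace of `f` is `g`-stable, hence the sum of its intersections with
those of `g`. If the latter are lines, each intersection is zero or the whole line, and each line is
spanned by a common eigenvector. -/

theorem Module.End.hasEigenvalue_of_maxGenEigenspace_ne_bot {μ : K}
    (h : g.maxGenEigenspace μ ≠ ⊥) : g.HasEigenvalue μ :=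
  End.HasUnifEigenvalue.lt (k := ⊤) zero_lt_one h

theorem Submodule.exists_smul_eq_of_finrank_eq_one {W : Submodule K V} (hW : finrank K W = 1)
    (hf : Set.MapsTo f W W) {v : V} (hv : v ∈ W) : ∃ c : K, f v = c • v := by
  by_cases h0 : v = 0
  · exact ⟨0, by simp [h0]⟩
  obtain ⟨c, hc⟩ := (finrank_eq_one_iff_of_nonzero' (⟨v, hv⟩ : W) (by simpa using h0)).mp hW
    ⟨f v, hf hv⟩
  exact ⟨c, (congrArg Subtype.val hc).symm⟩

variable [IsAlgClosed K] [FiniteDimensional K V]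

/-- Without `hg0`, the part of the `f`-space lying over the eigenvalue `0` of `g` could be missing
from the supremum. -/
theorem Module.End.maxGenEigenspace_eq_iSup_of_commute (hfg : Commute f g)
    (hg : ∀ ν, g.HasEigenvalue ν → finrank K (g.maxGenEigenspace ν) = 1)
    (hg0 : ¬ g.HasEigenvalue 0) (μ : K) :
    f.maxGenEigenspace μ =
      ⨆ ν : {ν // g.HasEigenvalue ν ∧ ν ≠ 0},
        ⨆ _ : finrank K ↥(f.maxGenEigenspace μ ⊓ g.maxGenEigenspace ν.1) ≠ 0,
          g.maxGenEigenspace ν.1 := by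
  apply le_antisymm
  · conv_lhs => rw [Submodule.eq_iSup_inf_genEigenspace ⊤
      (fun x hx => End.mapsTo_maxGenEigenspace_of_comm hfg μ hx)
      (End.iSup_maxGenEigenspace_eq_top g)]
    refine iSup_le fun ν => ?_
    by_cases h : f.maxGenEigenspace μ ⊓ g.maxGenEigenspace ν = ⊥
    · exact h.le.trans bot_le
    have hν : g.HasEigenvalue ν := End.hasEigenvalue_of_maxGenEigenspace_ne_bot fun h0 =>
      h (by rw [h0, inf_bot_eq])
    have hr : finrank K ↥(f.maxGenEigenspace μ ⊓ g.maxGenEigenspace ν) ≠ 0 :=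
      fun h0 => h (Submodule.finrank_eq_zero.mp h0)
    exact inf_le_right.trans
      (le_iSup₂_of_le ⟨ν, hν, fun h0 => hg0 (h0 ▸ hν)⟩ hr le_rfl)
  · refine iSup₂_le fun ν h => ?_
    have h1 := hg ν.1 ν.2.1
    -- A nonzero subspace of a line is the line.
    have h2 : f.maxGenEigenspace μ ⊓ g.maxGenEigenspace ν.1 = g.maxGenEigenspace ν.1 :=
      Submodule.eq_of_le_of_finrank_le inf_le_right (by omega)
    exact inf_eq_right.mp h2

theorem Module.End.exists_basis_common_eigenvectors (hfg : Commute f g)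
    (hg : ∀ ν, g.HasEigenvalue ν → finrank K (g.maxGenEigenspace ν) = 1) :
    ∃ b : Basis (Fin (finrank K V)) K V,
      ∀ i, (∃ c : K, f (b i) = c • b i) ∧ ∃ d : K, g (b i) = d • b i := by
  let s : Set V := {v | (∃ c : K, f v = c • v) ∧ ∃ d : K, g v = d • v}
  have hs : ⊤ ≤ Submodule.span K s := by
    rw [← End.iSup_maxGenEigenspace_eq_top g]
    refine iSup_le fun ν v hv => Submodule.subset_span ?_
    -- The supremum runs over all scalars; a non-eigenvalue contributes only `0`.
    by_cases h : g.maxGenEigenspace ν = ⊥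
    · obtain rfl : v = 0 := by simpa [h] using hv
      exact ⟨⟨0, by simp⟩, ⟨0, by simp⟩⟩
    have h1 := hg ν (End.hasEigenvalue_of_maxGenEigenspace_ne_bot h)
    exact ⟨Submodule.exists_smul_eq_of_finrank_eq_one h1
        (End.mapsTo_maxGenEigenspace_of_comm hfg.symm ν) hv,
      Submodule.exists_smul_eq_of_finrank_eq_one h1
        (End.mapsTo_maxGenEigenspace_of_comm (Commute.refl g) ν) hv⟩
  let b := Basis.ofSpan hs
  have := FiniteDimensional.fintypeBasisIndex b
  refine ⟨b.reindex (Fintype.equivFinOfCardEq (finrank_eq_card_basis b).symm), fun i => ?_⟩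
  rw [Basis.reindex_apply]
  exact Basis.ofSpan_subset hs ⟨_, rfl⟩

end CommutingEndomorphisms

namespace MatrixRoots

variable {n : ℕ} {A L : Matrix (Fin n) (Fin n) ℂ}

theorem HasOnlySimpleEigenvalues.finrank_maxGenEigenspace (h : HasOnlySimpleEigenvalues L) (ν : ℂ)
    (hν : End.HasEigenvalue (Matrix.toLin' L) ν) :
    finrank ℂ (End.maxGenEigenspace (Matrix.toLin' L) ν) = 1 := by
  rw [LinearMap.finrank_maxGenEigenspace_eq, ← h ν hν, algMult, Matrix.charpoly_toLin']

theorem commute_toLin' (hAL : Commute A L) :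
    Commute (Matrix.toLin' A) (Matrix.toLin' L) := by
  rw [Commute, SemiconjBy, Module.End.mul_eq_comp, Module.End.mul_eq_comp, ← Matrix.toLin'_mul,
    ← Matrix.toLin'_mul, hAL.eq]

theorem commute_of_mem_complexRootLimits (hL : L ∈ complexRootLimits A) : Commute A L := by
  obtain ⟨c, B, -, -, -, hB, hlim⟩ := hL
  refine tendsto_nhds_unique (hlim.const_mul A) ?_
  refine (hlim.mul_const A).congr fun i => ?_
  rw [← hB i, ← pow_succ, ← pow_succ']

/-- Used only to make `L` invertible. -/
theorem norm_det_of_mem_complexRootLimits (hA : A.det ≠ 0) (hL : L ∈ complexRootLimits A) :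
    ‖L.det‖ = 1 := by
  obtain ⟨c, B, hc, hpos, -, hB, hlim⟩ := hL
  have h1 : Tendsto (fun i => ‖(B i).det‖) atTop (𝓝 ‖L.det‖) :=
    ((continuous_id.matrix_det.norm).tendsto L).comp hlim
  have h2 : Tendsto (fun i => ‖A.det‖ ^ ((c i : ℝ)⁻¹)) atTop (𝓝 (‖A.det‖ ^ (0 : ℝ))) :=
    tendsto_const_nhds.rpow (tendsto_inv_atTop_zero.comp
      (tendsto_natCast_atTop_atTop.comp hc.tendsto_atTop)) (Or.inl (norm_ne_zero_iff.mpr hA))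
  rw [Real.rpow_zero] at h2
  refine tendsto_nhds_unique h1 (h2.congr fun i => ?_)
  rw [← hB i, Matrix.det_pow, norm_pow,
    Real.pow_rpow_inv_natCast (norm_nonneg _) (Nat.one_le_iff_ne_zero.mp (hpos i).1)]

theorem not_hasEigenvalue_toLin'_zero (hA : A.det ≠ 0) :
    ¬ End.HasEigenvalue (Matrix.toLin' A) 0 := by
  intro h
  obtain ⟨v, hv⟩ := h.exists_hasEigenvector
  refine hv.2 (Matrix.eq_zero_of_mulVec_eq_zero hA ?_)
  simpa using hv.apply_eq_smul

theorem exists_isDiag_of_commute (hAL : Commute A L) (hL : HasOnlySimpleEigenvalues L) :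
    ∃ Z : Matrix (Fin n) (Fin n) ℂ, IsUnit Z ∧
      (Z⁻¹ * A * Z).IsDiag ∧ (Z⁻¹ * L * Z).IsDiag := by
  obtain ⟨b', hb'⟩ := End.exists_basis_common_eigenvectors (commute_toLin' hAL)
    hL.finrank_maxGenEigenspace
  obtain ⟨b, hb⟩ : ∃ b : Basis (Fin n) ℂ (Fin n → ℂ),
      ∀ i, (∃ c : ℂ, Matrix.toLin' A (b i) = c • b i) ∧
        ∃ d : ℂ, Matrix.toLin' L (b i) = d • b i :=
    ⟨b'.reindex (finCongr (finrank_fin_fun ℂ)), fun i => by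
      rw [Basis.reindex_apply]; exact hb' _⟩
  let Z := (Pi.basisFun ℂ (Fin n)).toMatrix b
  have hZ : IsUnit Z := by
    have := (Pi.basisFun ℂ (Fin n)).invertibleToMatrix b
    exact isUnit_of_invertible Z
  have key (M : Matrix (Fin n) (Fin n) ℂ) (h : ∀ i, ∃ c : ℂ, Matrix.toLin' M (b i) = c • b i) :
      (Z⁻¹ * M * Z).IsDiag := by
    choose c hc using h
    -- The columns of `Z` are the eigenvectors `b j`.
    have hMZ : M * Z = Z * Matrix.diagonal c := by
      ext i j
      have h1 := congrFun (hc j) i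
      rw [Matrix.toLin'_apply, Pi.smul_apply, smul_eq_mul] at h1
      rw [Matrix.mul_diagonal, mul_comm]
      exact h1
    rw [mul_assoc, hMZ, Matrix.nonsing_inv_mul_cancel_left _ _
      ((Matrix.isUnit_iff_isUnit_det Z).mp hZ)]
    exact Matrix.isDiag_diagonal c
  exact ⟨Z, hZ, key A fun i => (hb i).1, key L fun i => (hb i).2⟩

end MatrixRoots


theorem mainTheorem9 (n : ℕ) (A L : Matrix (Fin n) (Fin n) ℂ) (hA : A.det ≠ 0)
    (hL : L ∈ MatrixRoots.complexRootLimits A) :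
    (MatrixRoots.HasOnlySimpleEigenvalues L →
      ∀ lam : MatrixRoots.nonzeroEigenvalues A,
        MatrixRoots.genEigenspace (lam : ℂ) A =
          ⨆ nu : MatrixRoots.nonzeroEigenvalues L,
            ⨆ _ : MatrixRoots.multRearrangement A L lam nu ≠ 0,
              MatrixRoots.genEigenspace (nu : ℂ) L) ∧
    (MatrixRoots.HasOnlySimpleEigenvalues A →
      ∀ nu : MatrixRoots.nonzeroEigenvalues L,
        MatrixRoots.genEigenspace (nu : ℂ) L =
          ⨆ lam : MatrixRoots.nonzeroEigenvalues A,
            ⨆ _ : MatrixRoots.multRearrangement A L lam nu ≠ 0,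
              MatrixRoots.genEigenspace (lam : ℂ) A) ∧
    (MatrixRoots.HasOnlySimpleEigenvalues L ∨ MatrixRoots.HasOnlySimpleEigenvalues A →
      ∃ Z : Matrix (Fin n) (Fin n) ℂ, IsUnit Z ∧
        (Z⁻¹ * A * Z).IsDiag ∧ (Z⁻¹ * L * Z).IsDiag) := by
  have hAL := MatrixRoots.commute_of_mem_complexRootLimits hL
  have hcomm := MatrixRoots.commute_toLin' hAL
  have hLdet : L.det ≠ 0 := norm_ne_zero_iff.mp (by
    rw [MatrixRoots.norm_det_of_mem_complexRootLimits hA hL]; exact one_ne_zero)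
  refine ⟨fun h lam => ?_, fun h nu => ?_, ?_⟩
  · exact Module.End.maxGenEigenspace_eq_iSup_of_commute hcomm h.finrank_maxGenEigenspace
      (MatrixRoots.not_hasEigenvalue_toLin'_zero hLdet) lam
  · have := Module.End.maxGenEigenspace_eq_iSup_of_commute hcomm.symm h.finrank_maxGenEigenspace
      (MatrixRoots.not_hasEigenvalue_toLin'_zero hA) nu
    refine this.trans (iSup_congr fun lam => ?_)
    -- With the roles of `A` and `L` exchanged, the intersection appears in the opposite order.
    rw [inf_comm]
    rfl
  · rintro (h | h)
    · exact MatrixRoots.exists_isDiag_of_commute hAL h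
    · obtain ⟨Z, hZ, h1, h2⟩ := MatrixRoots.exists_isDiag_of_commute hAL.symm h
      exact ⟨Z, hZ, h2, h1⟩
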